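/- Fix a universal prefix machine $U$: a partial recursive map $(p,s)\mapsto U(p,s)$ on binary strings such that for every $s$ the set $\{p : U(p,s)\text{ halts}\}$ is prefix-free, and such that for every other map $V$ with these properties there is a constant $c_V$ such that whenever $V(p,s)=x$ there is a $q$ with $|q|\le |p|+c_V$ and $U(q,s)=x$. For binary strings let $K(x\mid s)=\min\{|p| : U(p,s)=x\}$ and $K(x)=K(x\mid\varepsilon)$, where $\varepsilon$ is the empty string; let $x^*$ be the lexicographically first among the shortest $p$ with $U(p,\varepsilon)=x$. Define $$I(x:y)=K(y)-K(y\mid x^*),\qquad I(x:y\mid z)=K(y\mid z)-K\bigl(y\mid x,K(x\mid z),z\bigr),$$ where the tuple in the last condition is encoded as one string in a fixed computable, uniquely decodable way. Lemma (generalized data processing inequality). For every constant $c\ge 0$ there is a constant $C\ge 0$, depending only on $c$ and $U$, such that for all binary strings $x,y,z$: if $|I(x:y\mid z^*)|\le c$, then $I(x:y)\le I(x:z)+C$. -/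

import Mathlib

/-- A (conditional) prefix machine: a partial recursive map `run` that takes a binary program `p`
and a binary side information `s`, such that for every fixed `s` the set of programs on which the
machine halts is prefix-free. -/
structure PrefixMachine where
  run : List Bool → List Bool →. List Bool
  partrec : Partrec₂ run
  prefixFree : ∀ s p q : List Bool, (run p s).Dom → (run q s).Dom → p <+: q → p = q

/-- Self-delimiting encoding of a pair of binary strings as one binary string:
`1^|x| 0 x y`. -/
def pairString (x y : List Bool) : List Bool :=
  List.replicate x.length true ++ false :: (x ++ y)

/-- The triple consisting of a string `x`, a natural number `n` (in binary) and a string `z`,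
encoded as one binary string. -/
def tripleString (x : List Bool) (n : ℕ) (z : List Bool) : List Bool :=
  pairString x (pairString n.bits z)

namespace PrefixMachine

/-- `U` is universal: it simulates every prefix machine `V`, with programs that are longer
by at most a constant that depends on `V` only. -/
def IsUniversal (U : PrefixMachine) : Prop :=
  ∀ V : PrefixMachine, ∃ c : ℕ, ∀ p s x : List Bool, x ∈ V.run p s →
    ∃ q : List Bool, q.length ≤ p.length + c ∧ x ∈ U.run q s

/-- Conditional complexity `K(x | s)`: the length of a shortest program that makes `U` output `x`
when given `s`. -/
noncomputable def condK (U : PrefixMachine) (x s : List Bool) : ℕ :=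
  sInf {n : ℕ | ∃ p : List Bool, p.length = n ∧ x ∈ U.run p s}

/-- The complexity `K(x)`: there is no side information. -/
noncomputable def K (U : PrefixMachine) (x : List Bool) : ℕ :=
  U.condK x []

/-- `p` is a shortest program for `x`, and the lexicographically first one of that length. -/
def IsFirstShortest (U : PrefixMachine) (x p : List Bool) : Prop :=
  x ∈ U.run p [] ∧ ∀ q : List Bool, x ∈ U.run q [] →
    p.length < q.length ∨ (p.length = q.length ∧ p ≤ q)

/-- The shortest description `x^*` of `x` (the lexicographically first one if there are several). -/
noncomputable def star (U : PrefixMachine) (x : List Bool) : List Bool :=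
  Classical.epsilon (U.IsFirstShortest x)

/-- Algorithmic mutual information `I(x : y) = K(y) - K(y | x^*)`. -/
noncomputable def mutualInfo (U : PrefixMachine) (x y : List Bool) : ℤ :=
  (U.K y : ℤ) - (U.condK y (U.star x) : ℤ)

/-- Conditional algorithmic mutual information
`I(x : y | z) = K(y | z) - K(y | x, K(x | z), z)`. -/
noncomputable def condMutualInfo (U : PrefixMachine) (x y z : List Bool) : ℤ :=
  (U.condK y z : ℤ) - (U.condK y (tripleString x (U.condK x z) z) : ℤ)

/-- A universal machine has a program for every string, given any side information, so that the
infimum in `condK` is a minimum. -/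
theorem IsUniversal.exists_program {U : PrefixMachine} (hU : U.IsUniversal) (x s : List Bool) :
    ∃ p : List Bool, p.length = U.condK x s ∧ x ∈ U.run p s := by
  have hne : ∃ p : List Bool, x ∈ U.run p s := by
    let V : PrefixMachine :=
      { run := fun p _ => Part.ofOption (if p = [] then some x else none)
        partrec := by
          have h : Primrec₂ (fun p _ : List Bool =>
              ((if p = [] then some x else none) : Option (List Bool))) :=
            Primrec.ite (PrimrecRel.comp Primrec.eq Primrec.fst (Primrec.const []))
              (Primrec.const _) (Primrec.const _)
          exact Computable.ofOption h.to_comp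
        prefixFree := by
          intro s p q hp hq _
          have aux : ∀ r : List Bool,
              (Part.ofOption (if r = [] then some x else none)).Dom →
                r = [] := by
            intro r hr
            by_contra hne
            simp [hne] at hr
          rw [aux p hp, aux q hq] }
    obtain ⟨c, hc⟩ := hU V
    obtain ⟨q, _, hq⟩ := hc [] s x (by simp [V])
    exact ⟨q, hq⟩
  obtain ⟨p, hp⟩ := hne
  exact Nat.sInf_mem (s := {n : ℕ | ∃ p : List Bool, p.length = n ∧ x ∈ U.run p s})
    ⟨p.length, p, rfl, hp⟩

/-- For a universal machine, `x^*` is indeed the first shortest program for `x`. -/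
theorem IsUniversal.star_spec {U : PrefixMachine} (hU : U.IsUniversal) (x : List Bool) :
    U.IsFirstShortest x (U.star x) := by
  apply Classical.epsilon_spec (p := U.IsFirstShortest x)
  obtain ⟨p, hp, hx⟩ := hU.exists_program x []
  have hfin : {q : List Bool | q.length = U.condK x [] ∧ x ∈ U.run q []}.Finite :=
    (List.finite_length_eq Bool (U.condK x [])).subset fun q hq => hq.1
  obtain ⟨m, hm, hmin⟩ := Set.exists_min_image _ id hfin ⟨p, hp, hx⟩
  refine ⟨m, hm.2, fun q hq => ?_⟩
  have hle : U.condK x [] ≤ q.length := Nat.sInf_le ⟨q, rfl, hq⟩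
  rcases hle.lt_or_eq with h | h
  · exact Or.inl (hm.1 ▸ h)
  · exact Or.inr ⟨hm.1.trans h, hmin q ⟨h.symm, hq⟩⟩

end PrefixMachine

/-! All relations here hold up to an additive constant. By symmetry of information, K(x,y) = K(x) +
K(y | x*), so that I(x:y) = K(x) + K(y) - K(x,y). Heuristically, I(x:y) + I(x:z | y*) = I(x:z) +
I(x:y | z*); the second term is nonnegative by subadditivity and the last is bounded by assumption.
Concretely, the assumption turns conditional symmetry of information into K(x | z*) + K(y | z*) ≤
K(x,y | z*). Expanding K(x,y,z) once from z* and once from y*, with K(x,z | y*) ≤ K(x | y*) + K(z |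
y*), then gives the claim by linear arithmetic.

The weight lies on the lower bound for K(x,y) in symmetry of information,
`IsUniversal.condK_add_condK_le`. By the coding theorem, `IsUniversal.coding`, the programs for
pairs (x, ·) given s weigh at most a constant times 2^(-K(x | s)). Once x, K(x | s) and s are known,
these programs can be enumerated, and shortening each by K(x | s), up to a constant, leaves total
weight at most one. The Kraft–Chaitin theorem `IsUniversal.kraft_chaitin` turns the result into
codes for y. It also yields the coding theorem itself. The upper bound, `IsUniversal.condK_pair_le`,
is concatenation of programs. -/

/-! ### Primitive recursive sums, stages and unbounded search -/

theorem Primrec.nat_pow : Primrec₂ ((· ^ ·) : ℕ → ℕ → ℕ) :=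
  Primrec₂.unpaired'.1 Nat.Primrec.pow

theorem Primrec.sum_range {α : Type*} [Primcodable α] {f : α → ℕ → ℕ} {b : α → ℕ}
    (hf : Primrec₂ f) (hb : Primrec b) :
    Primrec fun a => ∑ i ∈ Finset.range (b a), f a i := by
  have h : Primrec fun a => Nat.rec (motive := fun _ => ℕ) 0 (fun i acc => acc + f a i) (b a) :=
    Primrec.nat_rec' hb (Primrec.const 0)
      (Primrec.nat_add.comp (Primrec.snd.comp Primrec.snd)
        (hf.comp Primrec.fst (Primrec.fst.comp Primrec.snd))).to₂
  refine h.of_eq fun a => ?_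
  induction b a with
  | zero => rfl
  | succ n ih => rw [Finset.sum_range_succ, ← ih]

/-- A partial recursive function is the limit of a primitive recursive sequence of
approximations. -/
theorem Partrec.exists_primrec_stage {α σ : Type*} [Primcodable α] [Primcodable σ]
    {f : α →. σ} (hf : Partrec f) :
    ∃ E : α → ℕ → Option σ, Primrec₂ E ∧ (∀ a x, x ∈ f a ↔ ∃ t, E a t = some x) ∧
      ∀ a x t t', t ≤ t' → E a t = some x → E a t' = some x := by
  obtain ⟨c, hc⟩ := Nat.Partrec.Code.exists_code.1 hf
  refine ⟨fun a t => (c.evaln t (Encodable.encode a)).bind Encodable.decode, ?_, ?_, ?_⟩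
  · exact Primrec.option_bind
      (Nat.Partrec.Code.primrec_evaln.comp
        (((Primrec.snd).pair (Primrec.const c)).pair (Primrec.encode.comp Primrec.fst)))
      (Primrec.decode.comp Primrec.snd).to₂
  · intro a x
    have key : ∀ m, m ∈ c.eval (Encodable.encode a) ↔ ∃ y ∈ f a, Encodable.encode y = m := by
      intro m; rw [hc]; simp
    constructor
    · intro hx
      obtain ⟨t, ht⟩ := Nat.Partrec.Code.evaln_complete.1 ((key _).2 ⟨x, hx, rfl⟩)
      exact ⟨t, by simp [Option.mem_def.1 ht]⟩
    · rintro ⟨t, ht⟩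
      obtain ⟨m, hm, hx⟩ := Option.bind_eq_some_iff.1 ht
      obtain ⟨y, hy, rfl⟩ := (key m).1 (Nat.Partrec.Code.evaln_sound hm)
      simp only [Encodable.encodek, Option.some.injEq] at hx
      exact hx ▸ hy
  · intro a x t t' htt ht
    obtain ⟨m, hm, hx⟩ := Option.bind_eq_some_iff.1 ht
    exact Option.bind_eq_some_iff.2 ⟨m, Nat.Partrec.Code.evaln_mono htt hm, hx⟩

/-- A function defined by unbounded search, when all successful searches agree. -/
theorem Nat.mem_rfindOpt_of_unique {σ : Type*} {f : ℕ → Option σ}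
    (hf : ∀ m n x y, f m = some x → f n = some y → x = y) (x : σ) :
    x ∈ Nat.rfindOpt f ↔ ∃ n, f n = some x := by
  constructor
  · exact fun h => Nat.rfindOpt_spec h
  · rintro ⟨n, hn⟩
    have hd : (Nat.rfindOpt f).Dom := Nat.rfindOpt_dom.2 ⟨n, x, hn⟩
    obtain ⟨m, hm⟩ := Nat.rfindOpt_spec (Part.get_mem hd)
    rw [hf n m x _ hn hm]
    exact Part.get_mem hd

/-! ### Kraft's inequality and dyadic intervals -/

/-- **Kraft's inequality** for a finite prefix-free set of binary strings. -/
theorem kraft_of_prefixFree (T : Finset (List Bool))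
    (hT : ∀ p ∈ T, ∀ q ∈ T, p <+: q → p = q) :
    ∑ p ∈ T, (1 / 2 : ℝ) ^ p.length ≤ 1 := by
  -- The code {[]} is prefix-free but not uniquely decodable, so Kraft–McMillan does not cover it.
  by_cases hnil : [] ∈ T
  · have : T = {[]} := by
      ext p
      simp only [Finset.mem_singleton]
      exact ⟨fun hp => (hT _ hnil _ hp List.nil_prefix).symm, fun h => h ▸ hnil⟩
    simp [this]
  · have hU : InformationTheory.UniquelyDecodable (T : Set (List Bool)) := by
      intro L₁
      induction L₁ with
      | nil =>
        intro L₂ _ h₂ h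
        cases L₂ with
        | nil => rfl
        | cons b L₂ =>
          have hb : b = [] := by simp_all
          exact absurd (hb ▸ h₂ b (by simp)) hnil
      | cons a L₁ ih =>
        intro L₂ h₁ h₂ h
        cases L₂ with
        | nil =>
          have ha : a = [] := by simp_all
          exact absurd (ha ▸ h₁ a (by simp)) hnil
        | cons b L₂ =>
          simp only [List.flatten_cons] at h
          have ha : a ∈ T := h₁ a (by simp)
          have hb : b ∈ T := h₂ b (by simp)
          have hab : a = b := by
            rcases List.prefix_or_prefix_of_prefix
              (List.prefix_append a L₁.flatten) (h ▸ List.prefix_append b L₂.flatten) with h' | h'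
            · exact hT _ ha _ hb h'
            · exact (hT _ hb _ ha h').symm
          subst hab
          rw [ih L₂ (fun w hw => h₁ w (by simp [hw])) (fun w hw => h₂ w (by simp [hw]))
            (List.append_cancel_left h)]
    simpa using InformationTheory.kraft_mcmillan_inequality hU

/-- The number with binary digits `p`, the most significant one first. -/
def binValue (p : List Bool) : ℕ := p.foldl (fun a b => 2 * a + b.toNat) 0

theorem binValue_append_singleton (p : List Bool) (b : Bool) :
    binValue (p ++ [b]) = 2 * binValue p + b.toNat := by
  simp [binValue]

/-- Extending a word shrinks its dyadic interval [v / 2^L, (v + 1) / 2^L], where v is the value of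
the word and L its length. -/
theorem binValue_append (p r : List Bool) :
    binValue p * 2 ^ r.length ≤ binValue (p ++ r) ∧
      binValue (p ++ r) + 1 ≤ (binValue p + 1) * 2 ^ r.length := by
  induction r using List.reverseRecOn with
  | nil => simp
  | append_singleton r b ih =>
    rw [← List.append_assoc, binValue_append_singleton, List.length_append, List.length_singleton,
      pow_succ]
    have := Bool.toNat_le b
    constructor <;> nlinarith [ih.1, ih.2]

theorem exists_binValue_eq (L v : ℕ) (hv : v < 2 ^ L) :
    ∃ p : List Bool, p.length = L ∧ binValue p = v := by
  induction L generalizing v with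
  | zero => exact ⟨[], rfl, by simp_all [binValue]⟩
  | succ L ih =>
    obtain ⟨p, hp, hpv⟩ := ih (v / 2) (by omega)
    refine ⟨p ++ [decide (v % 2 = 1)], by simp [hp], ?_⟩
    rw [binValue_append_singleton, hpv]
    rcases Nat.mod_two_eq_zero_or_one v with h | h <;> simp [h] <;> omega

theorem primrec_binValue : Primrec binValue :=
  Primrec.list_foldl Primrec.id (Primrec.const 0)
    (Primrec.nat_add.comp (Primrec.nat_double.comp (Primrec.fst.comp Primrec.snd))
      ((Primrec.dom_bool Bool.toNat).comp (Primrec.snd.comp Primrec.snd))).to₂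

/-! ### The Kraft–Chaitin theorem -/

namespace PrefixMachine

theorem condK_le_length {U : PrefixMachine} {p s x : List Bool} (h : x ∈ U.run p s) :
    U.condK x s ≤ p.length :=
  Nat.sInf_le ⟨p, rfl, h⟩

/-- A search that defines a prefix machine gives upper bounds for the conditional complexity. -/
theorem IsUniversal.condK_le_of_search {U : PrefixMachine} (hU : U.IsUniversal)
    {G : List Bool × List Bool → ℕ → Option (List Bool)} (hG : Primrec₂ G)
    (hpf : ∀ s p q m n x y, G (p, s) m = some x → G (q, s) n = some y → p <+: q → p = q ∧ x = y) :
    ∃ C : ℕ, ∀ p s x n, G (p, s) n = some x → U.condK x s ≤ p.length + C := by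
  -- The case q = p of `hpf` makes all successful searches on p agree.
  have hmem : ∀ p s x, x ∈ Nat.rfindOpt (G (p, s)) ↔ ∃ n, G (p, s) n = some x := fun p s x =>
    Nat.mem_rfindOpt_of_unique
      (fun m n x y hx hy => (hpf s p p m n x y hx hy (List.prefix_refl p)).2) x
  let V : PrefixMachine :=
    { run := fun p s => Nat.rfindOpt (G (p, s))
      partrec := Partrec.rfindOpt hG.to_comp
      prefixFree := by
        intro s p q hp hq hpq
        obtain ⟨m, hm⟩ := (hmem p s _).1 (Part.get_mem hp)
        obtain ⟨n, hn⟩ := (hmem q s _).1 (Part.get_mem hq)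
        exact (hpf s p q m n _ _ hm hn hpq).1 }
  obtain ⟨C, hC⟩ := hU V
  refine ⟨C, fun p s x n h => ?_⟩
  obtain ⟨q, hq, hx⟩ := hC p s x ((hmem p s x).2 ⟨n, h⟩)
  exact (condK_le_length hx).trans hq

end PrefixMachine

/-- Whether `t` is the first stage at which `F a` is true. -/
def isFirstStage {α : Type*} (F : α → ℕ → Bool) (a : α) (t : ℕ) : Bool :=
  F a t && decide (∑ i ∈ Finset.range t, (F a i).toNat = 0)

theorem primrec_isFirstStage {α : Type*} [Primcodable α] {F : α → ℕ → Bool} (hF : Primrec₂ F) :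
    Primrec₂ (isFirstStage F) := by
  refine Primrec.and.comp hF (Primrec.eq.decide.comp ?_ (Primrec.const 0))
  refine Primrec.sum_range (f := fun (x : α × ℕ) i => (F x.1 i).toNat) ?_ Primrec.snd
  exact (Primrec.dom_bool Bool.toNat).comp
    (hF.comp (Primrec.fst.comp Primrec.fst) Primrec.snd)

theorem isFirstStage_iff {α : Type*} {F : α → ℕ → Bool} {a : α} {t : ℕ} :
    isFirstStage F a t = true ↔ F a t = true ∧ ∀ i < t, F a i = false := by
  simp [isFirstStage]

theorem isFirstStage_unique {α : Type*} {F : α → ℕ → Bool} {a : α} {t t' : ℕ}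
    (h : isFirstStage F a t = true) (h' : isFirstStage F a t' = true) : t = t' := by
  rw [isFirstStage_iff] at h h'
  rcases lt_trichotomy t t' with hlt | heq | hlt
  · simpa [h.1] using h'.2 _ hlt
  · exact heq
  · simpa [h'.1] using h.2 _ hlt

theorem exists_isFirstStage {α : Type*} {F : α → ℕ → Bool} {a : α} (h : ∃ t, F a t = true) :
    ∃ t, isFirstStage F a t = true := by
  classical
  refine ⟨Nat.find h, isFirstStage_iff.2 ⟨Nat.find_spec h, fun i hi => ?_⟩⟩
  simpa using Nat.find_min h hi

/-- The `n`-th request, if there is one, of the enumeration without repetition of the set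
`{r | ∃ t, F (s, r) t}` of requests (output, code length). -/
def request (F : List Bool × List Bool × ℕ → ℕ → Bool) (s : List Bool) (n : ℕ) :
    Option (List Bool × ℕ) :=
  (Encodable.decode₂ (List Bool × ℕ) n.unpair.1).bind fun r =>
    if isFirstStage F (s, r) n.unpair.2 = true then some r else none

theorem request_eq_some_iff {F : List Bool × List Bool × ℕ → ℕ → Bool} {s : List Bool} {n : ℕ}
    {r : List Bool × ℕ} :
    request F s n = some r ↔
      Encodable.encode r = n.unpair.1 ∧ isFirstStage F (s, r) n.unpair.2 = true := by
  simp only [request, Option.bind_eq_some_iff, Option.ite_none_right_eq_some, Option.some.injEq]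
  constructor
  · rintro ⟨r', h, h', rfl⟩
    exact ⟨Encodable.mem_decode₂.1 h, h'⟩
  · rintro ⟨h, h'⟩
    exact ⟨r, Encodable.mem_decode₂.2 h, h', rfl⟩

theorem primrec_request {F : List Bool × List Bool × ℕ → ℕ → Bool} (hF : Primrec₂ F) :
    Primrec₂ (request F) := by
  refine Primrec.option_bind (Primrec.decode₂.comp
    (Primrec.fst.comp (Primrec.unpair.comp Primrec.snd))) ?_
  refine Primrec.ite (Primrec.eq.comp ?_ (Primrec.const true))
    (Primrec.option_some.comp Primrec.snd) (Primrec.const none)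
  exact (primrec_isFirstStage hF).comp
    ((Primrec.fst.comp Primrec.fst).pair Primrec.snd)
    (Primrec.snd.comp (Primrec.unpair.comp (Primrec.snd.comp Primrec.fst)))

theorem request_injective {F : List Bool × List Bool × ℕ → ℕ → Bool} {s : List Bool} {m n : ℕ}
    {r : List Bool × ℕ} (hm : request F s m = some r) (hn : request F s n = some r) : m = n := by
  rw [request_eq_some_iff] at hm hn
  rw [← Nat.pair_unpair m, ← Nat.pair_unpair n, ← hm.1, ← hn.1, isFirstStage_unique hm.2 hn.2]

/-- Because the number of a request dominates its code length, the subtraction in `requestWeight` is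
never truncated and the scaled weight is exact. -/
theorem request_length_le {F : List Bool × List Bool × ℕ → ℕ → Bool} {s : List Bool} {n : ℕ}
    {r : List Bool × ℕ} (h : request F s n = some r) : r.2 ≤ n := by
  rw [request_eq_some_iff] at h
  calc r.2 ≤ Encodable.encode r := by
        rw [Encodable.encode_prod_val]
        exact Nat.right_le_pair _ _
    _ = n.unpair.1 := h.1
    _ ≤ n := Nat.unpair_left_le n

/-- `2 ^ n` times the total weight `∑ 2 ^ (-l)` of the requests before the `n`-th. -/
def requestWeight (F : List Bool × List Bool × ℕ → ℕ → Bool) (s : List Bool) (n : ℕ) : ℕ :=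
  ∑ i ∈ Finset.range n, ((request F s i).map fun r => 2 ^ (n - r.2)).getD 0

theorem primrec_requestWeight {F : List Bool × List Bool × ℕ → ℕ → Bool} (hF : Primrec₂ F) :
    Primrec₂ (requestWeight F) := by
  have hpow : Primrec₂ fun (x : (List Bool × ℕ) × ℕ) (r : List Bool × ℕ) =>
      2 ^ (x.1.2 - r.2) :=
    Primrec.nat_pow.comp (Primrec.const 2) (Primrec.nat_sub.comp
      (Primrec.snd.comp (Primrec.fst.comp Primrec.fst)) (Primrec.snd.comp Primrec.snd))
  have hterm : Primrec₂ fun (x : List Bool × ℕ) (i : ℕ) =>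
      ((request F x.1 i).map fun r => 2 ^ (x.2 - r.2)).getD 0 :=
    Primrec.option_getD.comp (Primrec.option_map
      ((primrec_request hF).comp (Primrec.fst.comp Primrec.fst) Primrec.snd) hpow)
      (Primrec.const 0)
  exact Primrec.sum_range hterm Primrec.snd

theorem requestWeight_eq (F : List Bool × List Bool × ℕ → ℕ → Bool) (s : List Bool) (n : ℕ) :
    (requestWeight F s n : ℝ) = 2 ^ n *
      ∑ i ∈ Finset.range n, ((request F s i).map fun r => (1 / 2 : ℝ) ^ r.2).getD 0 := by
  rw [requestWeight, Nat.cast_sum, Finset.mul_sum]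
  refine Finset.sum_congr rfl fun i hi => ?_
  cases h : request F s i with
  | none => simp
  | some r =>
    have hr : r.2 ≤ n := (request_length_le h).trans (Finset.mem_range.1 hi).le
    simp only [Option.map_some, Option.getD_some, Nat.cast_pow, Nat.cast_ofNat]
    rw [pow_sub₀ _ two_ne_zero hr, one_div, inv_pow]

/-- The `n`-th request is served by the programs whose dyadic interval lies between the total
weights before and after that request. -/
def kraftChaitinSearch (F : List Bool × List Bool × ℕ → ℕ → Bool) (a : List Bool × List Bool)
    (n : ℕ) : Option (List Bool) :=
  (request F a.2 n).bind fun r =>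
    if a.1.length = r.2 + 1 ∧ requestWeight F a.2 n * 2 ^ a.1.length ≤ binValue a.1 * 2 ^ n ∧
      (binValue a.1 + 1) * 2 ^ (n + 1) ≤ requestWeight F a.2 (n + 1) * 2 ^ a.1.length
    then some r.1 else none

theorem primrec_kraftChaitinSearch {F : List Bool × List Bool × ℕ → ℕ → Bool} (hF : Primrec₂ F) :
    Primrec₂ (kraftChaitinSearch F) := by
  have hp : Primrec fun x : ((List Bool × List Bool) × ℕ) × List Bool × ℕ => x.1.1.1 :=
    Primrec.fst.comp (Primrec.fst.comp Primrec.fst)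
  have hs : Primrec fun x : ((List Bool × List Bool) × ℕ) × List Bool × ℕ => x.1.1.2 :=
    Primrec.snd.comp (Primrec.fst.comp Primrec.fst)
  have hn : Primrec fun x : ((List Bool × List Bool) × ℕ) × List Bool × ℕ => x.1.2 :=
    Primrec.snd.comp Primrec.fst
  have hn' := Primrec.succ.comp hn
  have hl := Primrec.list_length.comp hp
  have hv := primrec_binValue.comp hp
  have two_pow : ∀ {f : ((List Bool × List Bool) × ℕ) × List Bool × ℕ → ℕ}, Primrec f →
      Primrec fun x => 2 ^ f x := fun hf => Primrec.nat_pow.comp (Primrec.const 2) hf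
  refine Primrec.option_bind ((primrec_request hF).comp (Primrec.snd.comp Primrec.fst)
    Primrec.snd) ?_
  refine Primrec.ite (PrimrecPred.and ?_ (PrimrecPred.and ?_ ?_))
    (Primrec.option_some.comp (Primrec.fst.comp Primrec.snd)) (Primrec.const none)
  · exact Primrec.eq.comp hl (Primrec.succ.comp (Primrec.snd.comp Primrec.snd))
  · exact Primrec.nat_le.comp
      (Primrec.nat_mul.comp ((primrec_requestWeight hF).comp hs hn) (two_pow hl))
      (Primrec.nat_mul.comp hv (two_pow hn))
  · exact Primrec.nat_le.comp
      (Primrec.nat_mul.comp (Primrec.succ.comp hv) (two_pow hn'))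
      (Primrec.nat_mul.comp ((primrec_requestWeight hF).comp hs hn') (two_pow hl))

/-- The total weight `∑ 2 ^ (-l)` of the requests before the `n`-th. -/
noncomputable def requestSum (F : List Bool × List Bool × ℕ → ℕ → Bool) (s : List Bool) (n : ℕ) :
    ℝ :=
  ∑ i ∈ Finset.range n, ((request F s i).map fun r => (1 / 2 : ℝ) ^ r.2).getD 0

theorem requestSum_mono (F : List Bool × List Bool × ℕ → ℕ → Bool) (s : List Bool) :
    Monotone (requestSum F s) := by
  refine monotone_nat_of_le_succ fun n => ?_
  rw [requestSum, requestSum, Finset.sum_range_succ]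
  cases h : request F s n with
  | none => simp
  | some r => simp

/-- No request is enumerated twice, so a partial sum over stages is a sum over a set of requests,
the form in which Kraft's condition is assumed. -/
theorem exists_finset_requestSum (F : List Bool × List Bool × ℕ → ℕ → Bool) (s : List Bool)
    (n : ℕ) :
    ∃ G : Finset (List Bool × ℕ), (∀ r ∈ G, ∃ i < n, request F s i = some r) ∧
      requestSum F s n = ∑ r ∈ G, (1 / 2 : ℝ) ^ r.2 := by
  induction n with
  | zero => exact ⟨∅, by simp, by simp [requestSum]⟩
  | succ n ih =>
    obtain ⟨G, hG, hsum⟩ := ih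
    have hs : requestSum F s (n + 1) = requestSum F s n +
        ((request F s n).map fun r => (1 / 2 : ℝ) ^ r.2).getD 0 := Finset.sum_range_succ _ _
    cases h : request F s n with
    | none =>
      refine ⟨G, fun r hr => ?_, by rw [hs, hsum, h]; simp⟩
      obtain ⟨i, hi, hr⟩ := hG r hr
      exact ⟨i, by omega, hr⟩
    | some r =>
      have hr : r ∉ G := fun hr => by
        obtain ⟨i, hi, hr⟩ := hG r hr
        exact hi.ne (request_injective hr h)
      refine ⟨insert r G, fun r' hr' => ?_, ?_⟩
      · rcases Finset.mem_insert.1 hr' with rfl | hr'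
        · exact ⟨n, by omega, h⟩
        · obtain ⟨i, hi, hr⟩ := hG r' hr'
          exact ⟨i, by omega, hr⟩
      · rw [Finset.sum_insert hr, hs, hsum, h]
        simp [add_comm]

theorem kraftChaitinSearch_eq_some_iff {F : List Bool × List Bool × ℕ → ℕ → Bool}
    {p s x : List Bool} {n : ℕ} :
    kraftChaitinSearch F (p, s) n = some x ↔
      ∃ l, request F s n = some (x, l) ∧ p.length = l + 1 ∧
        requestSum F s n * 2 ^ p.length ≤ binValue p ∧
        (binValue p : ℝ) + 1 ≤ requestSum F s (n + 1) * 2 ^ p.length := by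
  have h1 : requestWeight F s n * 2 ^ p.length ≤ binValue p * 2 ^ n ↔
      requestSum F s n * 2 ^ p.length ≤ binValue p := by
    rw [← Nat.cast_le (α := ℝ)]
    push_cast
    rw [requestWeight_eq, mul_assoc, mul_comm (binValue p : ℝ)]
    exact mul_le_mul_iff_right₀ (by positivity)
  have h2 : (binValue p + 1) * 2 ^ (n + 1) ≤ requestWeight F s (n + 1) * 2 ^ p.length ↔
      (binValue p : ℝ) + 1 ≤ requestSum F s (n + 1) * 2 ^ p.length := by
    rw [← Nat.cast_le (α := ℝ)]
    push_cast
    rw [requestWeight_eq, mul_assoc, mul_comm ((binValue p : ℝ) + 1)]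
    exact mul_le_mul_iff_right₀ (by positivity)
  simp only [kraftChaitinSearch, Option.bind_eq_some_iff, Option.ite_none_right_eq_some,
    Option.some.injEq, h1, h2]
  constructor
  · rintro ⟨⟨w, l⟩, hr, ⟨h, h', h''⟩, rfl⟩
    exact ⟨l, hr, h, h', h''⟩
  · rintro ⟨l, hr, h, h', h''⟩
    exact ⟨(x, l), hr, ⟨h, h', h''⟩, rfl⟩

/-- Different stages own non-overlapping intervals of accumulated weight, while the interval of q
lies inside that of its prefix p. Kraft's condition plays no role, so the machine is prefix-free
even for side information on which the requests are too heavy. -/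
theorem kraftChaitinSearch_stage_unique {F : List Bool × List Bool × ℕ → ℕ → Bool}
    {p q s x y : List Bool} {m n : ℕ} (hp : kraftChaitinSearch F (p, s) m = some x)
    (hq : kraftChaitinSearch F (q, s) n = some y) (hpq : p <+: q) : m = n := by
  obtain ⟨_, _, _, hp1, hp2⟩ := kraftChaitinSearch_eq_some_iff.1 hp
  obtain ⟨_, _, _, hq1, hq2⟩ := kraftChaitinSearch_eq_some_iff.1 hq
  obtain ⟨r, rfl⟩ := hpq
  have hv1 : (binValue p : ℝ) * 2 ^ r.length ≤ binValue (p ++ r) := by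
    exact_mod_cast (binValue_append p r).1
  have hv2 : (binValue (p ++ r) : ℝ) + 1 ≤ (binValue p + 1) * 2 ^ r.length := by
    exact_mod_cast (binValue_append p r).2
  rw [List.length_append, pow_add, ← mul_assoc] at hq1 hq2
  have hr : (0 : ℝ) < 2 ^ r.length := by positivity
  have hpos : (0 : ℝ) < 2 ^ p.length := by positivity
  by_contra hne
  rcases lt_or_gt_of_ne hne with h | h
  · have hS : requestSum F s (m + 1) ≤ requestSum F s n := requestSum_mono F s h
    have h3 := mul_le_mul_of_nonneg_right hp2 hr.le
    have h4 := mul_le_mul_of_nonneg_right (mul_le_mul_of_nonneg_right hS hpos.le) hr.le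
    linarith
  · have hS : requestSum F s (n + 1) ≤ requestSum F s m := requestSum_mono F s h
    have h3 := mul_le_mul_of_nonneg_right hp1 hr.le
    have h4 := mul_le_mul_of_nonneg_right (mul_le_mul_of_nonneg_right hS hpos.le) hr.le
    linarith

namespace PrefixMachine

/-- The **Kraft–Chaitin theorem**: if, given `s`, the enumerable set of requests `(w, l)` has
total weight `∑ 2 ^ (-l)` at most one, then every requested `w` has complexity at most `l`, up to
a constant. -/
theorem IsUniversal.kraft_chaitin {U : PrefixMachine} (hU : U.IsUniversal)
    {F : List Bool × List Bool × ℕ → ℕ → Bool} (hF : Primrec₂ F) :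
    ∃ C : ℕ, ∀ s : List Bool,
      (∀ G : Finset (List Bool × ℕ), (∀ r ∈ G, ∃ t, F (s, r) t = true) →
        ∑ r ∈ G, (1 / 2 : ℝ) ^ r.2 ≤ 1) →
      ∀ w l, (∃ t, F (s, w, l) t = true) → U.condK w s ≤ l + C := by
  obtain ⟨C, hC⟩ := hU.condK_le_of_search (primrec_kraftChaitinSearch hF) (by
    intro s p q m n x y hp hq hpq
    obtain rfl := kraftChaitinSearch_stage_unique hp hq hpq
    obtain ⟨l, hr, hl, _⟩ := kraftChaitinSearch_eq_some_iff.1 hp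
    obtain ⟨l', hr', hl', _⟩ := kraftChaitinSearch_eq_some_iff.1 hq
    rw [hr, Option.some.injEq, Prod.mk.injEq] at hr'
    exact ⟨hpq.eq_of_length (by omega), hr'.1⟩)
  -- The extra bit pays for alignment: an interval of length 2^(-l) contains a dyadic one of length
  -- 2^(-(l+1)).
  refine ⟨C + 1, fun s hs w l hwl => ?_⟩
  obtain ⟨t, ht⟩ := exists_isFirstStage hwl
  obtain ⟨n, hn⟩ : ∃ n, request F s n = some (w, l) :=
    ⟨Nat.pair (Encodable.encode (w, l)) t, request_eq_some_iff.2 (by simpa using ht)⟩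
  have hsum : requestSum F s (n + 1) ≤ 1 := by
    obtain ⟨G, hG, hGsum⟩ := exists_finset_requestSum F s (n + 1)
    rw [hGsum]
    refine hs G fun r hr => ?_
    obtain ⟨i, _, hi⟩ := hG r hr
    exact ⟨_, (isFirstStage_iff.1 (request_eq_some_iff.1 hi).2).1⟩
  have hsucc : requestSum F s (n + 1) * 2 ^ (l + 1) = requestSum F s n * 2 ^ (l + 1) + 2 := by
    rw [requestSum, Finset.sum_range_succ, ← requestSum, hn, Option.map_some, Option.getD_some,
      add_mul, pow_succ, ← mul_assoc ((1 / 2 : ℝ) ^ l), ← mul_pow]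
    norm_num
  have hnonneg : 0 ≤ requestSum F s n * 2 ^ (l + 1) := by
    have : requestSum F s 0 ≤ requestSum F s n := requestSum_mono F s (Nat.zero_le n)
    rw [requestSum, Finset.sum_range_zero] at this
    positivity
  have hceil := Nat.ceil_lt_add_one hnonneg
  have hpow : (0 : ℝ) < 2 ^ (l + 1) := by positivity
  have hle : requestSum F s (n + 1) * 2 ^ (l + 1) ≤ 2 ^ (l + 1) := by nlinarith
  -- In units of 2^(-(l+1)) the interval of the request has length 2, so the unit interval starting
  -- at the rounded-up left end fits in it.
  obtain ⟨p, hp, hpv⟩ := exists_binValue_eq (l + 1) ⌈requestSum F s n * 2 ^ (l + 1)⌉₊ (by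
    rw [← Nat.cast_lt (α := ℝ)]
    push_cast
    linarith)
  have := hC p s w n (kraftChaitinSearch_eq_some_iff.2 ⟨l, hn, hp, by
    rw [hp, hpv]; exact Nat.le_ceil _, by rw [hp, hpv]; linarith⟩)
  omega

end PrefixMachine

/-! ### The coding theorem -/

/-- `2 ^ t` times the total weight of the programs that are seen, within `t` stages of `E`, to
output `a.2` given `a.1`. -/
def outputWeight (E : List Bool × List Bool → ℕ → Option (List Bool))
    (a : List Bool × List Bool) (t : ℕ) : ℕ :=
  ∑ i ∈ Finset.range t, ((Encodable.decode₂ (List Bool) i).map fun p =>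
    if E (p, a.1) t = some a.2 then 2 ^ (t - p.length) else 0).getD 0

theorem primrec_outputWeight {E : List Bool × List Bool → ℕ → Option (List Bool)}
    (hE : Primrec₂ E) : Primrec₂ (outputWeight E) := by
  have hite : Primrec₂ fun (x : ((List Bool × List Bool) × ℕ) × ℕ) (p : List Bool) =>
      if E (p, x.1.1.1) x.1.2 = some x.1.1.2 then 2 ^ (x.1.2 - p.length) else 0 := by
    have hx : Primrec fun y : (((List Bool × List Bool) × ℕ) × ℕ) × List Bool => y.1.1 :=
      Primrec.fst.comp Primrec.fst
    refine Primrec.ite (Primrec.eq.comp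
      (hE.comp (Primrec.snd.pair (Primrec.fst.comp (Primrec.fst.comp hx)))
        (Primrec.snd.comp hx))
      (Primrec.option_some.comp (Primrec.snd.comp (Primrec.fst.comp hx)))) ?_ (Primrec.const 0)
    exact Primrec.nat_pow.comp (Primrec.const 2) (Primrec.nat_sub.comp
      (Primrec.snd.comp hx) (Primrec.list_length.comp Primrec.snd))
  have hterm : Primrec₂ fun (x : (List Bool × List Bool) × ℕ) (i : ℕ) =>
      ((Encodable.decode₂ (List Bool) i).map fun p =>
        if E (p, x.1.1) x.2 = some x.1.2 then 2 ^ (x.2 - p.length) else 0).getD 0 :=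
    Primrec.option_getD.comp
      (Primrec.option_map (Primrec.decode₂.comp Primrec.snd) hite) (Primrec.const 0)
  exact Primrec.sum_range hterm Primrec.snd

theorem outputWeight_eq (E : List Bool × List Bool → ℕ → Option (List Bool))
    (s x : List Bool) (t : ℕ) :
    (outputWeight E (s, x) t : ℝ) = 2 ^ t *
      ∑ p ∈ ((Finset.range t).preimage Encodable.encode Encodable.encode_injective.injOn).filter
        (fun p => E (p, s) t = some x), (1 / 2 : ℝ) ^ p.length := by
  rw [outputWeight, ← Finset.sum_preimage (Encodable.encode : List Bool → ℕ) (Finset.range t)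
    Encodable.encode_injective.injOn]
  · rw [Finset.sum_filter, Nat.cast_sum, Finset.mul_sum]
    refine Finset.sum_congr rfl fun p hp => ?_
    rw [Encodable.encodek₂, Option.map_some, Option.getD_some]
    split_ifs
    · have hpt : p.length ≤ t := (Encodable.length_le_encode p).trans
        (Finset.mem_range.1 (Finset.mem_preimage.1 hp)).le
      push_cast
      rw [pow_sub₀ _ two_ne_zero hpt, one_div, inv_pow]
    · simp
  · intro i _ hi
    cases h : Encodable.decode₂ (List Bool) i with
    | none => rfl
    | some p => exact absurd ⟨p, Encodable.mem_decode₂.1 h⟩ hi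

theorem sum_half_pow_le_of_le (L : Finset ℕ) (m : ℕ) (hL : ∀ l ∈ L, m ≤ l) :
    ∑ l ∈ L, (1 / 2 : ℝ) ^ l ≤ 2 * (1 / 2) ^ m := by
  have hsub : L ⊆ Finset.Ico m (L.sup id + 1) := fun l hl =>
    Finset.mem_Ico.2 ⟨hL l hl, Nat.lt_succ_of_le (Finset.le_sup (f := id) hl)⟩
  calc ∑ l ∈ L, (1 / 2 : ℝ) ^ l ≤ ∑ l ∈ Finset.Ico m (L.sup id + 1), (1 / 2 : ℝ) ^ l :=
        Finset.sum_le_sum_of_subset_of_nonneg hsub fun _ _ _ => by positivity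
    _ ≤ 2 * (1 / 2) ^ m := by
        rw [Finset.sum_Ico_eq_sum_range]
        simp_rw [pow_add]
        rw [← Finset.mul_sum, mul_comm]
        have h2 : ∑ i ∈ Finset.range (L.sup id + 1 - m), (1 / 2 : ℝ) ^ i ≤ 2 :=
          sum_geometric_two_le _
        exact mul_le_mul_of_nonneg_right h2 (by positivity)

namespace PrefixMachine

theorem kraft (V : PrefixMachine) (s : List Bool) (T : Finset (List Bool))
    (hT : ∀ p ∈ T, (V.run p s).Dom) : ∑ p ∈ T, (1 / 2 : ℝ) ^ p.length ≤ 1 :=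
  kraft_of_prefixFree T fun p hp q hq h => V.prefixFree s p q (hT p hp) (hT q hq) h

/-- The requests `(x, l)` such that the programs of `V` for `x` weigh more than `2 ^ (1 - l)` have
total weight at most one. -/
theorem sum_le_one_of_heavy (V : PrefixMachine) (s : List Bool) (G : Finset (List Bool × ℕ))
    (hG : ∀ r ∈ G, ∃ T : Finset (List Bool), (∀ p ∈ T, r.1 ∈ V.run p s) ∧
      2 * (1 / 2 : ℝ) ^ r.2 < ∑ p ∈ T, (1 / 2 : ℝ) ^ p.length) :
    ∑ r ∈ G, (1 / 2 : ℝ) ^ r.2 ≤ 1 := by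
  classical
  choose! T hT hTlt using hG
  let P : List Bool → Finset (List Bool) := fun x => (G.filter fun r => r.1 = x).biUnion T
  have hP : ∀ x, ∀ p ∈ P x, x ∈ V.run p s := by
    intro x p hp
    obtain ⟨r, hr, hpr⟩ := Finset.mem_biUnion.1 hp
    obtain ⟨hr, hrx⟩ := Finset.mem_filter.1 hr
    exact hrx ▸ hT r hr p hpr
  -- One output may be requested with many lengths. They are distinct, so a geometric series bounds
  -- them by twice the weight of the shortest; this is the factor 2 in the threshold.
  have hfiber : ∀ x ∈ G.image Prod.fst, ∑ r ∈ G with r.1 = x, (1 / 2 : ℝ) ^ r.2 ≤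
      ∑ p ∈ P x, (1 / 2 : ℝ) ^ p.length := by
    intro x hx
    obtain ⟨r₀, hr₀, rfl⟩ := Finset.mem_image.1 hx
    obtain ⟨r, hr, hmin⟩ := Finset.exists_min_image (G.filter fun r => r.1 = r₀.1) Prod.snd
      ⟨r₀, by simp [hr₀]⟩
    have hinj : Set.InjOn Prod.snd ((G.filter fun r => r.1 = r₀.1 : Finset _) :
        Set (List Bool × ℕ)) := by
      intro a ha b hb hab
      simp only [Finset.coe_filter, Set.mem_ofPred_eq] at ha hb
      exact Prod.ext (ha.2.trans hb.2.symm) hab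
    calc ∑ r ∈ G with r.1 = r₀.1, (1 / 2 : ℝ) ^ r.2
        = ∑ l ∈ (G.filter fun r => r.1 = r₀.1).image Prod.snd, (1 / 2 : ℝ) ^ l :=
          (Finset.sum_image hinj).symm
      _ ≤ 2 * (1 / 2) ^ r.2 := by
          refine sum_half_pow_le_of_le _ _ fun l hl => ?_
          obtain ⟨r', hr', rfl⟩ := Finset.mem_image.1 hl
          exact hmin r' hr'
      _ ≤ ∑ p ∈ T r, (1 / 2 : ℝ) ^ p.length := (hTlt r (Finset.mem_filter.1 hr).1).le
      _ ≤ ∑ p ∈ P r₀.1, (1 / 2 : ℝ) ^ p.length :=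
          Finset.sum_le_sum_of_subset_of_nonneg (Finset.subset_biUnion_of_mem T hr)
            fun _ _ _ => by positivity
  have hdisj : Set.PairwiseDisjoint (G.image Prod.fst : Set (List Bool)) P := by
    intro x _ y _ hxy
    refine Finset.disjoint_left.2 fun p hx hy => hxy ?_
    exact Part.mem_unique (hP x p hx) (hP y p hy)
  calc ∑ r ∈ G, (1 / 2 : ℝ) ^ r.2
      = ∑ x ∈ G.image Prod.fst, ∑ r ∈ G with r.1 = x, (1 / 2 : ℝ) ^ r.2 :=
        (Finset.sum_fiberwise_of_maps_to (fun r hr => Finset.mem_image_of_mem _ hr) _).symm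
    _ ≤ ∑ x ∈ G.image Prod.fst, ∑ p ∈ P x, (1 / 2 : ℝ) ^ p.length := Finset.sum_le_sum hfiber
    _ = ∑ p ∈ (G.image Prod.fst).biUnion P, (1 / 2 : ℝ) ^ p.length :=
        (Finset.sum_biUnion hdisj).symm
    _ ≤ 1 := V.kraft s _ fun p hp => by
        obtain ⟨x, _, hx⟩ := Finset.mem_biUnion.1 hp
        exact Part.dom_iff_mem.2 ⟨x, hP x p hx⟩

/-- The **coding theorem**: the programs of a prefix machine that output `x` given `s` have total
weight at most `2 ^ (-K(x | s))`, up to a constant factor. -/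
theorem IsUniversal.coding {U : PrefixMachine} (hU : U.IsUniversal) (V : PrefixMachine) :
    ∃ C : ℕ, ∀ (s x : List Bool) (T : Finset (List Bool)), (∀ p ∈ T, x ∈ V.run p s) →
      (∑ p ∈ T, (1 / 2 : ℝ) ^ p.length) * 2 ^ U.condK x s ≤ 2 ^ C := by
  classical
  obtain ⟨E, hE, hEV, hmono⟩ := Partrec.exists_primrec_stage V.partrec
  let F : List Bool × List Bool × ℕ → ℕ → Bool := fun a t =>
    decide (2 * 2 ^ t < outputWeight E (a.1, a.2.1) t * 2 ^ a.2.2)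
  have hF : Primrec₂ F := by
    have ha : Primrec fun y : (List Bool × List Bool × ℕ) × ℕ => y.1.2 :=
      Primrec.snd.comp Primrec.fst
    refine Primrec.nat_lt.decide.comp ?_ ?_
    · exact Primrec.nat_mul.comp (Primrec.const 2)
        (Primrec.nat_pow.comp (Primrec.const 2) Primrec.snd)
    · exact Primrec.nat_mul.comp ((primrec_outputWeight hE).comp
        ((Primrec.fst.comp Primrec.fst).pair (Primrec.fst.comp ha)) Primrec.snd)
        (Primrec.nat_pow.comp (Primrec.const 2) (Primrec.snd.comp ha))
  have hFiff : ∀ s x l t, F (s, x, l) t = true ↔ 2 * (1 / 2 : ℝ) ^ l <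
      ∑ p ∈ ((Finset.range t).preimage Encodable.encode Encodable.encode_injective.injOn).filter
        (fun p => E (p, s) t = some x), (1 / 2 : ℝ) ^ p.length := by
    intro s x l t
    rw [decide_eq_true_iff, ← Nat.cast_lt (α := ℝ)]
    push_cast
    rw [outputWeight_eq, mul_comm (2 : ℝ) (2 ^ t), mul_assoc, mul_lt_mul_iff_right₀ (by positivity),
      one_div, inv_pow, ← div_eq_mul_inv, div_lt_iff₀ (by positivity)]
  obtain ⟨C, hC⟩ := hU.kraft_chaitin hF
  refine ⟨C + 2, fun s x T hT => ?_⟩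
  have hK : ∀ l, 2 * (1 / 2 : ℝ) ^ l < ∑ p ∈ T, (1 / 2 : ℝ) ^ p.length →
      U.condK x s ≤ l + C := by
    intro l hl
    refine hC s (fun G hG => V.sum_le_one_of_heavy s G fun r hr => ?_) x l ?_
    · obtain ⟨t, ht⟩ := hG r hr
      exact ⟨_, fun p hp => (hEV _ _).2 ⟨t, (Finset.mem_filter.1 hp).2⟩, (hFiff _ _ _ _).1 ht⟩
    · choose! τ hτ using fun p hp => (hEV (p, s) x).1 (hT p hp)
      -- The stage must exceed the halting stages of the programs in T and also their codes, since
      -- stage t inspects only codes below t.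
      refine ⟨T.sup τ + T.sup (fun p => Encodable.encode p + 1), (hFiff _ _ _ _).2
        (hl.trans_le (Finset.sum_le_sum_of_subset_of_nonneg (fun p hp => ?_)
          fun _ _ _ => by positivity))⟩
      have h1 : τ p ≤ T.sup τ := Finset.le_sup hp
      have h2 : Encodable.encode p + 1 ≤ T.sup (fun p => Encodable.encode p + 1) :=
        Finset.le_sup (f := fun p => Encodable.encode p + 1) hp
      exact Finset.mem_filter.2 ⟨Finset.mem_preimage.2 (Finset.mem_range.2 (by omega)),
        hmono _ _ _ _ (by omega) (hτ p hp)⟩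
  by_contra! hlt
  have hT1 : ∑ p ∈ T, (1 / 2 : ℝ) ^ p.length ≤ 1 :=
    V.kraft s T fun p hp => Part.dom_iff_mem.2 ⟨x, hT p hp⟩
  have hCK : C + 2 < U.condK x s := by
    have : (2 : ℝ) ^ (C + 2) < 2 ^ U.condK x s :=
      hlt.trans_le (mul_le_of_le_one_left (by positivity) hT1)
    exact (pow_lt_pow_iff_right₀ one_lt_two).1 this
  obtain ⟨n, hn⟩ := Nat.exists_eq_add_of_lt hCK
  -- Here n + 2 = K(x | s) - C - 1, one less than the bound `hK` tolerates, while the assumed excess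
  -- makes the weight exceed 2 * 2^(-(n+2)).
  have := hK (n + 2) (by
    rw [hn, add_assoc, pow_add _ (C + 2), ← mul_assoc, mul_right_comm] at hlt
    have h1 : (1 : ℝ) < (∑ p ∈ T, (1 / 2 : ℝ) ^ p.length) * 2 ^ (n + 1) :=
      lt_of_mul_lt_mul_right (by rwa [one_mul]) (by positivity : (0 : ℝ) ≤ 2 ^ (C + 2))
    rw [← div_lt_iff₀ (by positivity)] at h1
    rw [pow_succ, one_div_pow]
    linarith)
  omega

end PrefixMachine

/-! ### Decoding pairs and triples -/

theorem replicate_true_append_inj {m n : ℕ} {a b : List Bool}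
    (h : List.replicate m true ++ false :: a = List.replicate n true ++ false :: b) :
    m = n ∧ a = b := by
  induction m generalizing n with
  | zero => cases n <;> simp_all [List.replicate_succ]
  | succ m ih =>
    cases n with
    | zero => simp [List.replicate_succ] at h
    | succ n =>
      rw [List.replicate_succ, List.replicate_succ, List.cons_append, List.cons_append] at h
      obtain ⟨rfl, rfl⟩ := ih (List.cons.inj h).2
      exact ⟨rfl, rfl⟩

theorem pairString_inj {x y x' y' : List Bool} (h : pairString x y = pairString x' y') :
    x = x' ∧ y = y' := by
  obtain ⟨hl, h⟩ := replicate_true_append_inj h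
  exact List.append_inj h hl

theorem primrec_pairString : Primrec₂ pairString := by
  have hrep : Primrec fun a : List Bool × List Bool => List.replicate a.1.length true := by
    refine (Primrec.list_map Primrec.fst (Primrec.const true).to₂).of_eq fun a => ?_
    simp
  exact Primrec.list_append.comp hrep (Primrec.list_cons.comp (Primrec.const false)
    (Primrec.list_append.comp Primrec.fst Primrec.snd))

/-- The inverse of `pairString`, as a partial function. -/
def unpairString (u : List Bool) : Part (List Bool × List Bool) :=
  Nat.rfindOpt fun n => (Encodable.decode (α := List Bool × List Bool) n).bind fun a =>
    if pairString a.1 a.2 = u then some a else none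

theorem partrec_unpairString : Partrec unpairString := by
  refine Partrec.rfindOpt (Primrec₂.to_comp ?_)
  refine Primrec.option_bind (Primrec.decode.comp Primrec.snd) ?_
  exact Primrec.ite (Primrec.eq.comp (primrec_pairString.comp (Primrec.fst.comp Primrec.snd)
    (Primrec.snd.comp Primrec.snd)) (Primrec.fst.comp Primrec.fst))
    (Primrec.option_some.comp Primrec.snd) (Primrec.const none)

theorem mem_unpairString {u : List Bool} {a : List Bool × List Bool} :
    a ∈ unpairString u ↔ pairString a.1 a.2 = u := by
  have key : ∀ n b, ((Encodable.decode (α := List Bool × List Bool) n).bind fun a =>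
      if pairString a.1 a.2 = u then some a else none) = some b ↔
      Encodable.decode (α := List Bool × List Bool) n = some b ∧ pairString b.1 b.2 = u := by
    intro n b
    simp only [Option.bind_eq_some_iff, Option.ite_none_right_eq_some, Option.some.injEq]
    constructor
    · rintro ⟨c, hc, h, rfl⟩
      exact ⟨hc, h⟩
    · rintro ⟨hb, h⟩
      exact ⟨b, hb, h, rfl⟩
  rw [unpairString, Nat.mem_rfindOpt_of_unique]
  · simp only [key]
    exact ⟨fun ⟨_, h⟩ => h.2, fun h => ⟨Encodable.encode a, Encodable.encodek a, h⟩⟩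
  · intro m n b c hb hc
    rw [key] at hb hc
    have := pairString_inj (hb.2.trans hc.2.symm)
    exact Prod.ext this.1 this.2

/-- `Nat.bits` puts the least significant digit first and `binValue` the most significant, hence the
reversal. -/
theorem binValue_reverse_bits (n : ℕ) : binValue n.bits.reverse = n := by
  induction n using Nat.binaryRec' with
  | zero => simp [binValue]
  | bit b n h ih =>
    rw [Nat.bits_append_bit n b h, List.reverse_cons, binValue_append_singleton, ih, Nat.bit_val]

/-- The inverse of `tripleString`, as a partial function. -/
def untripleString (u : List Bool) : Part (List Bool × ℕ × List Bool) :=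
  (unpairString u).bind fun a =>
    (unpairString a.2).map fun b => (a.1, binValue b.1.reverse, b.2)

theorem partrec_untripleString : Partrec untripleString := by
  refine partrec_unpairString.bind ?_
  refine (partrec_unpairString.comp (Computable.snd.comp Computable.snd)).map ?_
  refine Primrec₂.to_comp ?_
  exact (Primrec.fst.comp (Primrec.snd.comp Primrec.fst)).pair
    ((primrec_binValue.comp (Primrec.list_reverse.comp (Primrec.fst.comp Primrec.snd))).pair
      (Primrec.snd.comp Primrec.snd))

theorem mem_untripleString (x : List Bool) (n : ℕ) (z : List Bool) :
    (x, n, z) ∈ untripleString (tripleString x n z) := by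
  refine Part.mem_bind_iff.2 ⟨(x, pairString n.bits z), mem_unpairString.2 rfl, ?_⟩
  refine (Part.mem_map_iff _).2 ⟨(n.bits, z), mem_unpairString.2 rfl, ?_⟩
  simp [binValue_reverse_bits]

/-! ### Symmetry of information -/

namespace PrefixMachine

/-- The machine that applies the partial recursive function `f` to the output of `U`. -/
def mapOutput (U : PrefixMachine) {f : List Bool →. List Bool} (hf : Partrec f) :
    PrefixMachine where
  run p s := (U.run p s).bind f
  partrec := Partrec.bind U.partrec (hf.comp Computable.snd).to₂
  prefixFree s p q hp hq h := U.prefixFree s p q hp.fst hq.fst h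

theorem mem_mapOutput {U : PrefixMachine} {f : List Bool →. List Bool} (hf : Partrec f)
    {p s x : List Bool} : x ∈ (U.mapOutput hf).run p s ↔ ∃ w ∈ U.run p s, x ∈ f w :=
  Part.mem_bind_iff

/-- Partial recursive functions do not increase complexity. -/
theorem IsUniversal.condK_map_le {U : PrefixMachine} (hU : U.IsUniversal)
    {f : List Bool →. List Bool} (hf : Partrec f) :
    ∃ C : ℕ, ∀ w s v, v ∈ f w → U.condK v s ≤ U.condK w s + C := by
  obtain ⟨C, hC⟩ := hU (U.mapOutput hf)
  refine ⟨C, fun w s v hv => ?_⟩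
  obtain ⟨p, hp, hw⟩ := hU.exists_program w s
  obtain ⟨q, hq, hv⟩ := hC p s v ((mem_mapOutput hf).2 ⟨w, hw, hv⟩)
  exact hp ▸ (condK_le_length hv).trans hq

/-- A program for `x`, followed by a program for `y` that may use the former, describes the pair. -/
theorem IsUniversal.condK_pair_le {U : PrefixMachine} (hU : U.IsUniversal)
    {g : List Bool × List Bool → List Bool} (hg : Primrec g) :
    ∃ C : ℕ, ∀ p s x y, x ∈ U.run p s →
      U.condK (pairString x y) s ≤ p.length + U.condK y (g (p, s)) + C := by
  obtain ⟨E, hE, hEU, -⟩ := Partrec.exists_primrec_stage U.partrec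
  let G : List Bool × List Bool → ℕ → Option (List Bool) := fun a n =>
    (Encodable.decode (α := (List Bool × List Bool) × ℕ × ℕ) n).bind fun c =>
      if c.1.1 ++ c.1.2 = a.1 then
        (E (c.1.1, a.2) c.2.1).bind fun x =>
          (E (c.1.2, g (c.1.1, a.2)) c.2.2).map fun y => pairString x y
      else none
  have hG : Primrec₂ G := by
    have ha : Primrec fun x : ((List Bool × List Bool) × ℕ) × (List Bool × List Bool) × ℕ × ℕ =>
        x.1.1 := Primrec.fst.comp Primrec.fst
    have hp : Primrec fun x : ((List Bool × List Bool) × ℕ) × (List Bool × List Bool) × ℕ × ℕ =>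
        x.2.1.1 := Primrec.fst.comp (Primrec.fst.comp Primrec.snd)
    have hq : Primrec fun x : ((List Bool × List Bool) × ℕ) × (List Bool × List Bool) × ℕ × ℕ =>
        x.2.1.2 := Primrec.snd.comp (Primrec.fst.comp Primrec.snd)
    have ht : Primrec fun x : ((List Bool × List Bool) × ℕ) × (List Bool × List Bool) × ℕ × ℕ =>
        x.2.2 := Primrec.snd.comp Primrec.snd
    have hps := hp.pair (Primrec.snd.comp ha)
    have hE1 := hE.comp hps (Primrec.fst.comp ht)
    have hE2 := hE.comp (hq.pair (hg.comp hps)) (Primrec.snd.comp ht)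
    have hmap := Primrec.option_map (hE2.comp Primrec.fst)
      (primrec_pairString.comp (Primrec.snd.comp Primrec.fst) Primrec.snd).to₂
    exact Primrec.option_bind (Primrec.decode.comp Primrec.snd)
      (Primrec.ite (Primrec.eq.comp (Primrec.list_append.comp hp hq) (Primrec.fst.comp ha))
        (Primrec.option_bind hE1 hmap) (Primrec.const none))
  have hGiff : ∀ r s w, (∃ n, G (r, s) n = some w) ↔ ∃ p q x y, p ++ q = r ∧ x ∈ U.run p s ∧
      y ∈ U.run q (g (p, s)) ∧ pairString x y = w := by
    intro r s w
    simp only [G, Option.bind_eq_some_iff, Option.ite_none_right_eq_some, Option.map_eq_some_iff]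
    constructor
    · rintro ⟨n, ⟨⟨p, q⟩, t, t'⟩, -, h, x, hx, y, hy, hw⟩
      exact ⟨p, q, x, y, h, (hEU (p, s) x).2 ⟨t, hx⟩, (hEU (q, g (p, s)) y).2 ⟨t', hy⟩, hw⟩
    · rintro ⟨p, q, x, y, h, hx, hy, hw⟩
      obtain ⟨t, ht⟩ := (hEU (p, s) x).1 hx
      obtain ⟨t', ht'⟩ := (hEU (q, g (p, s)) y).1 hy
      exact ⟨_, ((p, q), t, t'), Encodable.encodek _, h, x, ht, y, ht', hw⟩
  obtain ⟨C, hC⟩ := hU.condK_le_of_search hG (by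
    intro s r r' m n w w' hm hn hr
    obtain ⟨p, q, x, y, rfl, hx, hy, rfl⟩ := (hGiff r s w).1 ⟨m, hm⟩
    obtain ⟨p', q', x', y', rfl, hx', hy', rfl⟩ := (hGiff r' s w').1 ⟨n, hn⟩
    have hd := Part.dom_iff_mem.2 ⟨x, hx⟩
    have hd' := Part.dom_iff_mem.2 ⟨x', hx'⟩
    -- The split of the input is unique: p and p' are prefixes of one word and both halt given s.
    -- Only then do q and q' run with the same side information and become comparable.
    obtain rfl : p = p' := by
      rcases List.prefix_or_prefix_of_prefix
        ((List.prefix_append p q).trans hr) (List.prefix_append p' q') with h | h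
      · exact U.prefixFree s p p' hd hd' h
      · exact (U.prefixFree s p' p hd' hd h).symm
    obtain rfl : q = q' := U.prefixFree _ q q' (Part.dom_iff_mem.2 ⟨y, hy⟩)
      (Part.dom_iff_mem.2 ⟨y', hy'⟩) ((List.prefix_append_right_inj p).1 hr)
    rw [Part.mem_unique hx hx', Part.mem_unique hy hy']
    exact ⟨rfl, rfl⟩)
  refine ⟨C, fun p s x y hx => ?_⟩
  obtain ⟨q, hq, hy⟩ := hU.exists_program y (g (p, s))
  obtain ⟨n, hn⟩ := (hGiff (p ++ q) s _).2 ⟨p, q, x, y, rfl, hx, hy, rfl⟩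
  have := hC _ _ _ _ hn
  rwa [List.length_append, hq] at this

/-- The hard direction of the symmetry of information: if `x`, `K(x | s)` and `s` can be computed
from `u`, then `K(x | s) + K(y | u) ≤ K(x, y | s)`, up to a constant. -/
theorem IsUniversal.condK_add_condK_le {U : PrefixMachine} (hU : U.IsUniversal)
    {d : List Bool →. List Bool × ℕ × List Bool} (hd : Partrec d) :
    ∃ C : ℕ, ∀ u x y s, (x, U.condK x s, s) ∈ d u →
      U.condK x s + U.condK y u ≤ U.condK (pairString x y) s + C := by
  classical
  have hfst : Partrec fun w => (unpairString w).map Prod.fst :=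
    partrec_unpairString.map (Computable.fst.comp Computable.snd).to₂
  obtain ⟨B, hB⟩ := hU.coding (U.mapOutput hfst)
  -- Projecting to the first component makes every program for a pair (x, ·) a program for x, so the
  -- coding theorem bounds their joint weight.
  have hB : ∀ (s x : List Bool) (T : Finset (List Bool)),
      (∀ p ∈ T, ∃ y, pairString x y ∈ U.run p s) →
      (∑ p ∈ T, (1 / 2 : ℝ) ^ p.length) * 2 ^ U.condK x s ≤ 2 ^ B := by
    refine fun s x T hT => hB s x T fun p hp => ?_
    obtain ⟨y, hy⟩ := hT p hp
    exact (mem_mapOutput hfst).2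
      ⟨_, hy, (Part.mem_map_iff _).2 ⟨(x, y), mem_unpairString.2 rfl, rfl⟩⟩
  obtain ⟨E, hE, hEU, -⟩ := Partrec.exists_primrec_stage U.partrec
  obtain ⟨D, hD, hDd, -⟩ := Partrec.exists_primrec_stage hd
  -- A program p for (x, y) given s requests y with length |p| + B - k, where (x, k, s) is decoded
  -- from u. The equation is written additively to avoid truncated subtraction.
  let F : List Bool × List Bool × ℕ → ℕ → Bool := fun a n =>
    ((Encodable.decode (α := (List Bool × ℕ × List Bool) × List Bool × ℕ × ℕ) n).map fun c =>
      decide (D a.1 c.2.2.1 = some c.1 ∧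
        E (c.2.1, c.1.2.2) c.2.2.2 = some (pairString c.1.1 a.2.1) ∧
        a.2.2 + c.1.2.1 = c.2.1.length + B)).getD false
  have hF : Primrec₂ F := by
    let X := ((List Bool × List Bool × ℕ) × ℕ) × (List Bool × ℕ × List Bool) × List Bool × ℕ × ℕ
    have ha : Primrec fun z : X => z.1.1 := Primrec.fst.comp Primrec.fst
    have hc : Primrec fun z : X => z.2.1 := Primrec.fst.comp Primrec.snd
    have hp : Primrec fun z : X => z.2.2.1 := Primrec.fst.comp (Primrec.snd.comp Primrec.snd)
    have ht : Primrec fun z : X => z.2.2.2 := Primrec.snd.comp (Primrec.snd.comp Primrec.snd)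
    have h1 : PrimrecPred fun z : X => D z.1.1.1 z.2.2.2.1 = some z.2.1 :=
      Primrec.eq.comp (hD.comp (Primrec.fst.comp ha) (Primrec.fst.comp ht))
        (Primrec.option_some.comp hc)
    have h2 : PrimrecPred fun z : X =>
        E (z.2.2.1, z.2.1.2.2) z.2.2.2.2 = some (pairString z.2.1.1 z.1.1.2.1) :=
      Primrec.eq.comp (hE.comp (hp.pair (Primrec.snd.comp (Primrec.snd.comp hc)))
        (Primrec.snd.comp ht))
        (Primrec.option_some.comp (primrec_pairString.comp (Primrec.fst.comp hc)
          (Primrec.fst.comp (Primrec.snd.comp ha))))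
    have h3 : PrimrecPred fun z : X => z.1.1.2.2 + z.2.1.2.1 = z.2.2.1.length + B :=
      Primrec.eq.comp (Primrec.nat_add.comp (Primrec.snd.comp (Primrec.snd.comp ha))
        (Primrec.fst.comp (Primrec.snd.comp hc)))
        (Primrec.nat_add.comp (Primrec.list_length.comp hp) (Primrec.const B))
    exact Primrec.option_getD.comp (Primrec.option_map (Primrec.decode.comp Primrec.snd)
      (h1.and (h2.and h3)).decide.to₂) (Primrec.const false)
  have hFiff : ∀ u y l, (∃ n, F (u, y, l) n = true) ↔ ∃ x k s p, (x, k, s) ∈ d u ∧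
      pairString x y ∈ U.run p s ∧ l + k = p.length + B := by
    intro u y l
    have hget : ∀ o : Option Bool, o.getD false = true ↔ o = some true := by
      rintro (_ | b) <;> simp
    simp only [F, hget, Option.map_eq_some_iff, decide_eq_true_iff]
    constructor
    · rintro ⟨n, ⟨⟨x, k, s⟩, p, t, t'⟩, -, h1, h2, h3⟩
      exact ⟨x, k, s, p, (hDd u _).2 ⟨t, h1⟩, (hEU (p, s) _).2 ⟨t', h2⟩, h3⟩
    · rintro ⟨x, k, s, p, h1, h2, h3⟩
      obtain ⟨t, ht⟩ := (hDd u _).1 h1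
      obtain ⟨t', ht'⟩ := (hEU (p, s) _).1 h2
      exact ⟨_, ((x, k, s), p, t, t'), Encodable.encodek _, ht, ht', h3⟩
  obtain ⟨C, hC⟩ := hU.kraft_chaitin hF
  refine ⟨B + C, fun u x y s hu => ?_⟩
  -- Kraft's condition is checked only for this u, where the decoded k is the true K(x | s).
  -- Distinct requests come from distinct programs, and the factor 2^(K(x | s) - B) between their
  -- weights is what `hB` compensates.
  have hkraft : ∀ G : Finset (List Bool × ℕ), (∀ r ∈ G, ∃ t, F (u, r) t = true) →
      ∑ r ∈ G, (1 / 2 : ℝ) ^ r.2 ≤ 1 := by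
    intro G hG
    have hG' : ∀ r ∈ G, ∃ p, pairString x r.1 ∈ U.run p s ∧
        r.2 + U.condK x s = p.length + B := by
      intro r hr
      obtain ⟨x', k, s', p, h1, h2, h3⟩ := (hFiff u r.1 r.2).1 (hG r hr)
      obtain ⟨rfl, rfl, rfl⟩ : x' = x ∧ k = U.condK x s ∧ s' = s := by
        simpa using Part.mem_unique h1 hu
      exact ⟨p, h2, h3⟩
    choose! p hp hl using hG'
    have hinj : Set.InjOn p (G : Set (List Bool × ℕ)) := by
      intro r hr r' hr' h
      have h1 := hp r hr
      rw [h] at h1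
      have h2 := hl r hr
      rw [h, ← hl r' hr'] at h2
      exact Prod.ext (pairString_inj (Part.mem_unique h1 (hp r' hr'))).2 (by omega)
    have hweight : ∀ r ∈ G, (1 / 2 : ℝ) ^ r.2 * 2 ^ B =
        (1 / 2 : ℝ) ^ (p r).length * 2 ^ U.condK x s := by
      intro r hr
      rw [one_div_pow, one_div_pow, one_div_mul_eq_div, one_div_mul_eq_div,
        div_eq_div_iff (by positivity) (by positivity), ← pow_add, ← pow_add,
        add_comm B, ← hl r hr, add_comm r.2]
    have hsum : (∑ r ∈ G, (1 / 2 : ℝ) ^ r.2) * 2 ^ B ≤ 2 ^ B := by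
      rw [Finset.sum_mul, Finset.sum_congr rfl hweight, ← Finset.sum_mul,
        ← Finset.sum_image (f := fun q : List Bool => (1 / 2 : ℝ) ^ q.length) hinj]
      refine hB s x _ fun q hq => ?_
      obtain ⟨r, hr, rfl⟩ := Finset.mem_image.1 hq
      exact ⟨r.1, hp r hr⟩
    exact le_of_mul_le_mul_right (by rwa [one_mul]) (by positivity : (0 : ℝ) < 2 ^ B)
  obtain ⟨p, hp, hxy⟩ := hU.exists_program (pairString x y) s
  -- The coding bound for a single program shows that the requested length is a genuine difference.
  have hle : U.condK x s ≤ p.length + B := by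
    have h := hB s x {p} (by simpa using ⟨y, hxy⟩)
    rw [Finset.sum_singleton, one_div_pow, one_div_mul_eq_div, div_le_iff₀ (by positivity),
      ← pow_add] at h
    have := (pow_le_pow_iff_right₀ (one_lt_two (α := ℝ))).1 h
    omega
  have := hC u hkraft y (p.length + B - U.condK x s)
    ((hFiff _ _ _).2 ⟨x, _, s, p, hu, hxy, by omega⟩)
  omega

theorem IsUniversal.length_star {U : PrefixMachine} (hU : U.IsUniversal) (x : List Bool) :
    (U.star x).length = U.condK x [] := by
  obtain ⟨p, hp, hx⟩ := hU.exists_program x []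
  refine le_antisymm ?_ (condK_le_length (hU.star_spec x).1)
  rcases (hU.star_spec x).2 p hx with h | h <;> omega

theorem IsUniversal.condK_pair_star_le {U : PrefixMachine} (hU : U.IsUniversal) :
    ∃ C : ℕ, ∀ x y, U.K (pairString x y) ≤ U.K x + U.condK y (U.star x) + C := by
  obtain ⟨C, hC⟩ := hU.condK_pair_le (g := Prod.fst) Primrec.fst
  refine ⟨C, fun x y => ?_⟩
  have := hC (U.star x) [] x y (hU.star_spec x).1
  rwa [hU.length_star] at this

/-- The string x* carries both x, by running it, and K(x), as its length; x alone would not supply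
K(x). -/
theorem IsUniversal.K_add_condK_star_le {U : PrefixMachine} (hU : U.IsUniversal) :
    ∃ C : ℕ, ∀ x y, U.K x + U.condK y (U.star x) ≤ U.K (pairString x y) + C := by
  have hd : Partrec fun u => (U.run u []).map fun x => (x, u.length, ([] : List Bool)) := by
    refine Partrec.map (U.partrec.comp Computable.id (Computable.const [])) ?_
    exact (Primrec.snd.pair ((Primrec.list_length.comp Primrec.fst).pair
      (Primrec.const []))).to_comp.to₂
  obtain ⟨C, hC⟩ := hU.condK_add_condK_le hd
  refine ⟨C, fun x y => hC (U.star x) x y [] ?_⟩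
  exact (Part.mem_map_iff _).2 ⟨x, (hU.star_spec x).1, by rw [hU.length_star]⟩

theorem IsUniversal.condK_add_condK_triple_le {U : PrefixMachine} (hU : U.IsUniversal) :
    ∃ C : ℕ, ∀ x y s, U.condK x s + U.condK y (tripleString x (U.condK x s) s) ≤
      U.condK (pairString x y) s + C := by
  obtain ⟨C, hC⟩ := hU.condK_add_condK_le partrec_untripleString
  exact ⟨C, fun x y s => hC _ x y s (mem_untripleString _ _ _)⟩

theorem IsUniversal.condK_pair_le_add {U : PrefixMachine} (hU : U.IsUniversal) :
    ∃ C : ℕ, ∀ x y s, U.condK (pairString x y) s ≤ U.condK x s + U.condK y s + C := by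
  obtain ⟨C, hC⟩ := hU.condK_pair_le (g := Prod.snd) Primrec.snd
  refine ⟨C, fun x y s => ?_⟩
  obtain ⟨p, hp, hx⟩ := hU.exists_program x s
  exact hp ▸ hC p s x y hx

theorem IsUniversal.condK_pair_swap_le {U : PrefixMachine} (hU : U.IsUniversal) :
    ∃ C : ℕ, ∀ x y s, U.condK (pairString x y) s ≤ U.condK (pairString y x) s + C := by
  have hf : Partrec fun u => (unpairString u).map fun a => pairString a.2 a.1 :=
    partrec_unpairString.map (primrec_pairString.comp (Primrec.snd.comp Primrec.snd)
      (Primrec.fst.comp Primrec.snd)).to_comp.to₂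
  obtain ⟨C, hC⟩ := hU.condK_map_le hf
  exact ⟨C, fun x y s => hC _ s _
    ((Part.mem_map_iff _).2 ⟨(y, x), mem_unpairString.2 rfl, rfl⟩)⟩

theorem IsUniversal.condK_pair_rotate_le {U : PrefixMachine} (hU : U.IsUniversal) :
    ∃ C : ℕ, ∀ x y z s, U.condK (pairString z (pairString x y)) s ≤
      U.condK (pairString y (pairString x z)) s + C := by
  have hf : Partrec fun u => (unpairString u).bind fun a =>
      (unpairString a.2).map fun b => pairString b.2 (pairString b.1 a.1) := by
    refine partrec_unpairString.bind ?_
    refine (partrec_unpairString.comp (Computable.snd.comp Computable.snd)).map ?_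
    exact (primrec_pairString.comp (Primrec.snd.comp Primrec.snd)
      (primrec_pairString.comp (Primrec.fst.comp Primrec.snd)
        (Primrec.fst.comp (Primrec.snd.comp Primrec.fst)))).to_comp.to₂
  obtain ⟨C, hC⟩ := hU.condK_map_le hf
  refine ⟨C, fun x y z s => hC _ s _ ?_⟩
  refine Part.mem_bind_iff.2 ⟨(y, pairString x z), mem_unpairString.2 rfl, ?_⟩
  exact (Part.mem_map_iff _).2 ⟨(x, z), mem_unpairString.2 rfl, rfl⟩

end PrefixMachine

/-! ### The data processing inequality -/

theorem mainTheorem3 (U : PrefixMachine) (hU : U.IsUniversal) (c : ℕ) :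
    ∃ C : ℕ, ∀ x y z : List Bool,
      |U.condMutualInfo x y (U.star z)| ≤ (c : ℤ) →
        U.mutualInfo x y ≤ U.mutualInfo x z + (C : ℤ) := by
  obtain ⟨A, hA⟩ := hU.condK_pair_star_le
  obtain ⟨B, hB⟩ := hU.K_add_condK_star_le
  obtain ⟨D, hD⟩ := hU.condK_add_condK_triple_le
  obtain ⟨P, hP⟩ := hU.condK_pair_le_add
  obtain ⟨S, hS⟩ := hU.condK_pair_swap_le
  obtain ⟨R, hR⟩ := hU.condK_pair_rotate_le
  refine ⟨c + D + P + R + 4 * A + 4 * B + 3 * S, fun x y z h => ?_⟩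
  have hc := (abs_le.1 h).2
  unfold PrefixMachine.condMutualInfo at hc
  -- With `hc` this gives K(x | z*) + K(y | z*) ≤ K(x,y | z*) up to a constant.
  have h1 := hD x y (U.star z)
  -- The complexity of the triple is bounded below starting from z* and above starting from y*.
  have h2 := hB z (pairString x y)
  have h3 : U.K (pairString z (pairString x y)) ≤ U.K (pairString y (pairString x z)) + R :=
    hR x y z []
  have h4 := hA y (pairString x z)
  -- Subadditivity given y* plays the role of I(x:z | y*) ≥ 0.
  have h5 := hP x z (U.star y)
  -- The remaining bounds exchange the roles of the two strings in each pair. After K(y | z*)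
  -- cancels, K(x | z*) ≤ K(x) + K(y | x*) - K(y) is left, to be compared with K(x | z*) ≥ K(x) +
  -- K(z | x*) - K(z).
  have h6 := hB y x
  have h7 : U.K (pairString y x) ≤ U.K (pairString x y) + S := hS y x []
  have h8 := hB y z
  have h9 : U.K (pairString y z) ≤ U.K (pairString z y) + S := hS y z []
  have h10 := hA z y
  have h11 := hA z x
  have h12 : U.K (pairString x z) ≤ U.K (pairString z x) + S := hS x z []
  have h13 := hB x z
  have h14 := hA x y
  unfold PrefixMachine.mutualInfo
  omega
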